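/- Let $\mathcal{A}$ be a complex Banach algebra with identity $1$. For $a\in\mathcal{A}$ let $\{a\}'=\{c\in\mathcal{A}: ac=ca\}$, and let $\{a\}''$ be the set of elements of $\mathcal{A}$ commuting with every element of $\{a\}'$. Call $a$ quasinilpotent if $\sigma(a)=\{0\}$. Call $y$ a generalized Drazin inverse of $a$ if $y\in\{a\}'$, $yay=y$ and $a-a^{2}y$ is quasinilpotent; such a $y$ is unique if it exists and is denoted by $a^{d}$. Let $\mathcal{A}^{d}$ be the set of all elements having a generalized Drazin inverse, and let $\mathcal{A}^{acc}=\{a\in\mathcal{A}: a-\lambda 1\in\mathcal{A}^{d}\text{ for all }\lambda\in\mathbb{C}\setminus\{0\}\}$. Call $x$ an ag-Drazin inverse of $a$ if $x\in\{a\}'$, $xax=x$ and $a-a^{2}x\in\mathcal{A}^{acc}$, and let $\mathcal{A}^{ad}$ be the set of all elements having an ag-Drazin inverse. Let $a\in\mathcal{A}^{ad}$ and $b\in\mathcal{A}^{d}$ with $ab=ba=0$. Then $a+b\in\mathcal{A}^{ad}$. Moreover, $a$ has an ag-Drazin inverse belonging to $\{a\}''$, and for every ag-Drazin inverse $x$ of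 $a$ with $x\in\{a\}''$, the element $x+b^{d}$ is an ag-Drazin inverse of $a+b$. -/

import Mathlib

namespace AgDrazin

variable {A : Type*} [NormedRing A] [NormedAlgebra ℂ A]

/-- `a` is quasinilpotent: its spectrum is `{0}`. -/
def IsQuasinilpotent (a : A) : Prop :=
  spectrum ℂ a = {0}

/-- `x` is a generalized Drazin inverse of `a`: `x ∈ {a}'`, `x a x = x` and `a - a² x` is
quasinilpotent. -/
def IsGDrazinInverse (a x : A) : Prop :=
  x ∈ Set.centralizer ({a} : Set A) ∧ x * a * x = x ∧ IsQuasinilpotent (a - a ^ 2 * x)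

/-- `a` is generalized Drazin invertible. -/
def IsGDrazinInvertible (a : A) : Prop :=
  ∃ x : A, IsGDrazinInverse a x

/-- `a` belongs to the class `A^acc`: `a - λ 1` is generalized Drazin invertible for every
complex `λ ≠ 0`. -/
def IsAcc (a : A) : Prop :=
  ∀ z : ℂ, z ≠ 0 → IsGDrazinInvertible (a - algebraMap ℂ A z)

/-- `x` is an ag-Drazin inverse of `a`: `x ∈ {a}'`, `x a x = x` and `a - a² x` is in `A^acc`. -/
def IsAgDrazinInverse (a x : A) : Prop :=
  x ∈ Set.centralizer ({a} : Set A) ∧ x * a * x = x ∧ IsAcc (a - a ^ 2 * x)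

/-- `a` is ag-Drazin invertible. -/
def IsAgDrazinInvertible (a : A) : Prop :=
  ∃ x : A, IsAgDrazinInverse a x

end AgDrazin

/-!
An element commuting with an idempotent `e` is the Peirce sum of its parts on `e` and on `1 - e`,
and spectra and outer inverses can be computed on the two parts separately.

If `α ∈ A^acc` and a quasinilpotent `β` annihilate each other, then
`α + β - z = (α - z) (1 - z⁻¹ β)` has an invertible second factor, hence `α + β ∈ A^acc`. The
residuals `a - a² x` and `b - b² y` annihilate each other, so `x + y` is an ag-Drazin inverse of
`a + b`.

For an inverse of `a` in `{a}''`, let `s = a - a² x` be the residual of an ag-Drazin inverse `x`.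
The spectrum of `s` is discrete away from `0`, and a spectral idempotent at a nonzero point `l`
moves `l` out of `σ(s)` while only adding `l⁻¹` to `σ(x)`. Removing the finitely many points outside
a small disc gives `r(s) r(x) < 1`. For `c` commuting with `a`, each off-diagonal part `z` of `c`
relative to `a x` satisfies `z = sⁿ z xⁿ` or `z = xⁿ z sⁿ` for all `n`, so it vanishes, and `x`
commutes with `c`.
-/

open Filter Topology

namespace AgDrazin

section OuterInverse

variable {R : Type*} [Ring R] {a b x y : R}

/-- The part of `a` annihilated by a commuting outer inverse `x`; generalized Drazin and ag-Drazin
inverses are distinguished by the condition they impose on it. -/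
def residual (a x : R) : R :=
  a - a ^ 2 * x

/-- The algebraic part shared by generalized Drazin and ag-Drazin inverses: `x` commutes with `a`
and `x a x = x`. -/
structure IsCommutingOuterInverse (a x : R) : Prop where
  commute : Commute a x
  mul_mul_self : x * a * x = x

theorem residual_eq_mul_one_sub (a x : R) : residual a x = a * (1 - a * x) := by
  rw [residual]
  noncomm_ring

theorem commute_residual {c : R} (hca : Commute c a) (hcx : Commute c x) :
    Commute c (residual a x) :=
  hca.sub_right ((hca.pow_right 2).mul_right hcx)

theorem residual_zero_right (a : R) : residual a 0 = a := by
  rw [residual, mul_zero, sub_zero]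

theorem residual_units_inv (u : Rˣ) : residual (u : R) ↑u⁻¹ = 0 := by
  rw [residual_eq_mul_one_sub, u.mul_inv, sub_self, mul_zero]

theorem sq_mul_add_residual (a x : R) : a ^ 2 * x + residual a x = a :=
  add_sub_cancel _ _

theorem isCommutingOuterInverse_zero (a : R) : IsCommutingOuterInverse a 0 :=
  ⟨Commute.zero_right a, mul_zero _⟩

theorem isCommutingOuterInverse_units_inv (u : Rˣ) : IsCommutingOuterInverse (u : R) ↑u⁻¹ :=
  ⟨(Commute.refl (u : R)).units_inv_right, by rw [u.inv_mul, one_mul]⟩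

namespace IsCommutingOuterInverse

theorem isIdempotentElem_mul (h : IsCommutingOuterInverse a x) : IsIdempotentElem (a * x) := by
  rw [IsIdempotentElem, mul_assoc, ← mul_assoc x, h.mul_mul_self]

theorem commute_left_mul (h : IsCommutingOuterInverse a x) : Commute a (a * x) :=
  (Commute.refl a).mul_right h.commute

theorem commute_right_mul (h : IsCommutingOuterInverse a x) : Commute x (a * x) :=
  h.commute.symm.mul_right (Commute.refl x)

theorem mul_mul_right (h : IsCommutingOuterInverse a x) : a * x * x = x := by
  rw [h.commute.eq, h.mul_mul_self]

theorem commute_residual_mul (h : IsCommutingOuterInverse a x) : Commute (residual a x) (a * x) :=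
  (commute_residual h.commute_left_mul.symm h.commute_right_mul.symm).symm

theorem residual_eq_one_sub_mul (h : IsCommutingOuterInverse a x) :
    residual a x = (1 - a * x) * a := by
  rw [residual_eq_mul_one_sub, ((Commute.one_right a).sub_right h.commute_left_mul).eq]

theorem residual_mul_right (h : IsCommutingOuterInverse a x) : residual a x * x = 0 := by
  rw [residual]
  linear_combination (norm := noncomm_ring) -a * h.mul_mul_right

theorem right_mul_residual (h : IsCommutingOuterInverse a x) : x * residual a x = 0 := by
  rw [h.residual_eq_one_sub_mul]
  linear_combination (norm := noncomm_ring) -h.mul_mul_self * a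

theorem right_mul_eq_zero (h : IsCommutingOuterInverse a x) (hab : a * b = 0) : x * b = 0 := by
  rw [← h.mul_mul_self, mul_assoc x, h.commute.eq, mul_assoc, mul_assoc, hab, mul_zero, mul_zero]

theorem mul_right_eq_zero (h : IsCommutingOuterInverse a x) (hba : b * a = 0) : b * x = 0 := by
  rw [← h.mul_mul_right, ← mul_assoc, ← mul_assoc, hba, zero_mul, zero_mul]

theorem add (hx : IsCommutingOuterInverse a x) (hy : IsCommutingOuterInverse b y)
    (hab : a * b = 0) (hba : b * a = 0) : IsCommutingOuterInverse (a + b) (x + y) := by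
  have hay : a * y = 0 := hy.mul_right_eq_zero hab
  have hya : y * a = 0 := hy.right_mul_eq_zero hba
  have hbx : b * x = 0 := hx.mul_right_eq_zero hba
  have hxb : x * b = 0 := hx.right_mul_eq_zero hab
  constructor
  · rw [Commute, SemiconjBy]
    linear_combination (norm := noncomm_ring)
      hx.commute.eq + hy.commute.eq + hay + hbx - hya - hxb
  · linear_combination (norm := noncomm_ring) hx.mul_mul_self + hy.mul_mul_self +
      x * hay + y * hbx + hya * (x + y) + hxb * (x + y)

theorem residual_add (hx : IsCommutingOuterInverse a x) (hy : IsCommutingOuterInverse b y)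
    (hab : a * b = 0) (hba : b * a = 0) :
    residual (a + b) (x + y) = residual a x + residual b y := by
  simp only [residual]
  linear_combination (norm := noncomm_ring) -(a + b) * hy.mul_right_eq_zero hab -
    (a + b) * hx.mul_right_eq_zero hba - hab * y - hba * x

theorem residual_mul_residual (hx : IsCommutingOuterInverse a x) (hab : a * b = 0) :
    residual a x * residual b y = 0 := by
  rw [hx.residual_eq_one_sub_mul, residual_eq_mul_one_sub, mul_assoc, ← mul_assoc a, hab, zero_mul,
    mul_zero]

theorem sq_mul (h : IsCommutingOuterInverse a x) : IsCommutingOuterInverse (a ^ 2 * x) x where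
  commute := (h.commute.pow_left 2).mul_left (Commute.refl x)
  mul_mul_self := by
    linear_combination (norm := noncomm_ring) x * a * h.mul_mul_right + h.mul_mul_self

theorem residual_sq_mul (h : IsCommutingOuterInverse a x) : residual (a ^ 2 * x) x = 0 := by
  rw [residual]
  linear_combination (norm := noncomm_ring)
    -a ^ 2 * x * a * h.mul_mul_right - a ^ 2 * h.mul_mul_self

theorem sq_mul_mul_residual (h : IsCommutingOuterInverse a x) :
    a ^ 2 * x * residual a x = 0 := by
  rw [mul_assoc, h.right_mul_residual, mul_zero]

theorem residual_mul_sq_mul (h : IsCommutingOuterInverse a x) :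
    residual a x * (a ^ 2 * x) = 0 := by
  rw [(h.commute.pow_left 2).eq, ← mul_assoc, h.residual_mul_right, zero_mul]

theorem add_of_residual (hx : IsCommutingOuterInverse a x)
    (hy : IsCommutingOuterInverse (residual a x) y) : IsCommutingOuterInverse a (x + y) := by
  simpa only [sq_mul_add_residual] using
    hx.sq_mul.add hy hx.sq_mul_mul_residual hx.residual_mul_sq_mul

theorem residual_add_of_residual (hx : IsCommutingOuterInverse a x)
    (hy : IsCommutingOuterInverse (residual a x) y) :
    residual a (x + y) = residual (residual a x) y := by
  simpa only [sq_mul_add_residual, hx.residual_sq_mul, zero_add] using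
    hx.sq_mul.residual_add hy hx.sq_mul_mul_residual hx.residual_mul_sq_mul

end IsCommutingOuterInverse

end OuterInverse

section Peirce

variable {R : Type*} [Ring R] {e u v u' v' : R}

/-- The element that agrees with `u` on the idempotent `e` and with `v` on the complementary
idempotent `1 - e`. For `u` and `v` commuting with `e`, this is the Peirce decomposition of an
element of the centralizer of `e`. -/
def peirceSum (e u v : R) : R :=
  u * e + v * (1 - e)

theorem peirceSum_self (e u : R) : peirceSum e u u = u := by
  rw [peirceSum]
  noncomm_ring

theorem peirceSum_sub (e u v u' v' : R) :
    peirceSum e (u - u') (v - v') = peirceSum e u v - peirceSum e u' v' := by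
  simp only [peirceSum]
  noncomm_ring

theorem peirceSum_add_self (e u v w : R) : peirceSum e (u + w) (v + w) = peirceSum e u v + w := by
  simp only [peirceSum]
  noncomm_ring

theorem peirceSum_sub_self (e u v w : R) : peirceSum e (u - w) (v - w) = peirceSum e u v - w := by
  rw [peirceSum_sub, peirceSum_self]

theorem peirceSum_mul (he : IsIdempotentElem e) (hu' : Commute u' e) (hv' : Commute v' e) :
    peirceSum e u v * peirceSum e u' v' = peirceSum e (u * u') (v * v') := by
  simp only [peirceSum]
  linear_combination (norm := noncomm_ring)
    (u - v) * (u' - v') * he.eq - (u - v) * hu'.eq * e - (u - v) * hv'.eq * (1 - e)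

theorem peirceSum_peirceSum_left (he : IsIdempotentElem e) (u v w : R) :
    peirceSum e (peirceSum e u v) w = peirceSum e u w := by
  simp only [peirceSum]
  linear_combination (norm := noncomm_ring) (u - v) * he.eq

theorem commute_peirceSum (hu : Commute u e) (hv : Commute v e) : Commute (peirceSum e u v) e :=
  (hu.mul_left (Commute.refl e)).add_left
    (hv.mul_left ((Commute.one_left e).sub_left (Commute.refl e)))

theorem isUnit_peirceSum (he : IsIdempotentElem e) (hu : IsUnit u) (hv : IsUnit v)
    (hue : Commute u e) (hve : Commute v e) : IsUnit (peirceSum e u v) := by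
  obtain ⟨u, rfl⟩ := hu
  obtain ⟨v, rfl⟩ := hv
  refine ⟨⟨peirceSum e u v, peirceSum e ↑u⁻¹ ↑v⁻¹, ?_, ?_⟩, rfl⟩
  · rw [peirceSum_mul he hue.units_inv_left hve.units_inv_left, u.mul_inv, v.mul_inv,
      peirceSum_self]
  · rw [peirceSum_mul he hue hve, u.inv_mul, v.inv_mul, peirceSum_self]

theorem spectrum_peirceSum_subset {k A : Type*} [CommRing k] [Ring A] [Algebra k A] {e u v : A}
    (he : IsIdempotentElem e) (hue : Commute u e) (hve : Commute v e) :
    spectrum k (peirceSum e u v) ⊆ spectrum k u ∪ spectrum k v := by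
  intro z
  contrapose!
  simp only [Set.mem_union, not_or, spectrum.notMem_iff]
  rintro ⟨hu, hv⟩
  have hze : Commute (algebraMap k A z) e := Algebra.commute_algebraMap_left z e
  rw [← peirceSum_self e (algebraMap k A z), ← peirceSum_sub]
  exact isUnit_peirceSum he hu hv (hze.sub_left hue) (hze.sub_left hve)

theorem isCommutingOuterInverse_peirceSum {x y : R} (hx : IsCommutingOuterInverse u x)
    (hy : IsCommutingOuterInverse v y) (he : IsIdempotentElem e) (hue : Commute u e)
    (hve : Commute v e) (hxe : Commute x e) (hye : Commute y e) :
    IsCommutingOuterInverse (peirceSum e u v) (peirceSum e x y) where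
  commute := by
    rw [Commute, SemiconjBy, peirceSum_mul he hxe hye, peirceSum_mul he hue hve, hx.commute.eq,
      hy.commute.eq]
  mul_mul_self := by
    rw [peirceSum_mul he hue hve, peirceSum_mul he hxe hye, hx.mul_mul_self, hy.mul_mul_self]

theorem residual_peirceSum {x y : R} (he : IsIdempotentElem e) (hue : Commute u e)
    (hve : Commute v e) (hxe : Commute x e) (hye : Commute y e) :
    residual (peirceSum e u v) (peirceSum e x y) = peirceSum e (residual u x) (residual v y) := by
  simp only [residual, pow_two]
  rw [peirceSum_mul he hue hve, peirceSum_mul he hxe hye, peirceSum_sub]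

namespace IsCommutingOuterInverse

variable {a x : R}

theorem isUnit_peirceSum_one (h : IsCommutingOuterInverse a x) :
    IsUnit (peirceSum (a * x) a 1) := by
  have he : IsIdempotentElem (a * x) := h.isIdempotentElem_mul
  have hax : peirceSum (a * x) (a * x) 1 = 1 := by
    rw [peirceSum, he.eq]
    noncomm_ring
  refine ⟨⟨peirceSum (a * x) a 1, peirceSum (a * x) x 1, ?_, ?_⟩, rfl⟩
  · rw [peirceSum_mul he h.commute_right_mul (Commute.one_left _), one_mul, hax]
  · rw [peirceSum_mul he h.commute_left_mul (Commute.one_left _), one_mul, ← h.commute.eq, hax]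

theorem peirceSum_residual (h : IsCommutingOuterInverse a x) :
    peirceSum (a * x) (peirceSum (a * x) a 1) (residual a x) = a := by
  rw [peirceSum_peirceSum_left h.isIdempotentElem_mul, peirceSum, residual_eq_mul_one_sub]
  linear_combination (norm := noncomm_ring) a * h.isIdempotentElem_mul.eq

end IsCommutingOuterInverse

end Peirce

section OrthogonalSum

theorem algebraMap_sub_mul_algebraMap_sub {k A : Type*} [CommRing k] [Ring A] [Algebra k A] {z : k}
    {x y : A} (hxy : x * y = 0) : (algebraMap k A z - x) * (algebraMap k A z - y) =
      algebraMap k A z * (algebraMap k A z - (x + y)) := by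
  linear_combination (norm := noncomm_ring) hxy + Algebra.commutes z x

theorem spectrum_add_subset_of_mul_eq_zero {k A : Type*} [CommRing k] [Ring A] [Algebra k A]
    {x y : A} (hxy : x * y = 0) :
    spectrum k (x + y) ⊆ spectrum k x ∪ spectrum k y := by
  intro z
  contrapose!
  simp only [Set.mem_union, not_or, spectrum.notMem_iff]
  rintro ⟨hx, hy⟩
  have hcomm : Commute (algebraMap k A z) (algebraMap k A z - (x + y)) :=
    Algebra.commute_algebraMap_left z _
  exact (hcomm.isUnit_mul_iff.mp (algebraMap_sub_mul_algebraMap_sub (k := k) hxy ▸ hx.mul hy)).2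

end OrthogonalSum

section SpectralRadius

variable {A : Type*} [NormedRing A] [NormedAlgebra ℂ A] [CompleteSpace A] {a b c s x y z : A}

theorem spectralRadius_ne_top (a : A) : spectralRadius ℂ a ≠ ⊤ := by
  have h := spectrum.spectralRadius_le_pow_nnnorm_pow_one_div ℂ a 0
  exact ne_top_of_le_ne_top (by finiteness) h

theorem tendsto_nnnorm_pow_mul_nnnorm_pow (a b : A) :
    Tendsto (fun n : ℕ => ((‖a ^ n‖₊ * ‖b ^ n‖₊ : NNReal) : ENNReal) ^ (1 / n : ℝ)) atTop
      (𝓝 (spectralRadius ℂ a * spectralRadius ℂ b)) := by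
  refine (ENNReal.Tendsto.mul (spectrum.pow_nnnorm_pow_one_div_tendsto_nhds_spectralRadius a)
    (Or.inr (spectralRadius_ne_top b))
    (spectrum.pow_nnnorm_pow_one_div_tendsto_nhds_spectralRadius b)
    (Or.inr (spectralRadius_ne_top a))).congr fun n => ?_
  rw [ENNReal.coe_mul, ENNReal.mul_rpow_of_nonneg _ _ (by positivity)]

theorem spectralRadius_mul_le (h : Commute a b) :
    spectralRadius ℂ (a * b) ≤ spectralRadius ℂ a * spectralRadius ℂ b := by
  refine le_of_tendsto_of_tendsto'
    (spectrum.pow_nnnorm_pow_one_div_tendsto_nhds_spectralRadius (a * b))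
    (tendsto_nnnorm_pow_mul_nnnorm_pow a b) fun n => ?_
  refine ENNReal.rpow_le_rpow (ENNReal.coe_le_coe.mpr ?_) (by positivity)
  rw [h.mul_pow]
  exact nnnorm_mul_le _ _

theorem exists_nnnorm_pow_mul_nnnorm_pow_lt_one
    (h : spectralRadius ℂ a * spectralRadius ℂ b < 1) : ∃ n : ℕ, ‖a ^ n‖₊ * ‖b ^ n‖₊ < 1 := by
  obtain ⟨n, hlt, hn⟩ := (((tendsto_nnnorm_pow_mul_nnnorm_pow a b).eventually_lt_const h).and
    (eventually_gt_atTop 0)).exists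
  refine ⟨n, lt_of_not_ge fun hge => hlt.not_ge ?_⟩
  exact ENNReal.one_le_rpow (by exact_mod_cast hge) (by positivity)

theorem eq_pow_mul_mul_pow {M : Type*} [Monoid M] {s y z : M} (h : z = s * z * y) (n : ℕ) :
    z = s ^ n * z * y ^ n := by
  induction n with
  | zero => simp
  | succ n ih =>
    calc z = s ^ n * (s * z * y) * y ^ n := by rw [← h, ← ih]
      _ = s ^ (n + 1) * z * y ^ (n + 1) := by
        rw [pow_succ s, pow_succ' y]
        simp only [mul_assoc]

theorem eq_zero_of_eq_mul_mul (hr : spectralRadius ℂ s * spectralRadius ℂ y < 1)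
    (h : z = s * z * y) : z = 0 := by
  obtain ⟨n, hn⟩ := exists_nnnorm_pow_mul_nnnorm_pow_lt_one hr
  have hz : ‖z‖₊ ≤ ‖s ^ n‖₊ * ‖y ^ n‖₊ * ‖z‖₊ :=
    calc ‖z‖₊ = ‖s ^ n * z * y ^ n‖₊ := by rw [← eq_pow_mul_mul_pow h n]
      _ ≤ ‖s ^ n‖₊ * ‖z‖₊ * ‖y ^ n‖₊ := nnnorm_mul₃_le
      _ = ‖s ^ n‖₊ * ‖y ^ n‖₊ * ‖z‖₊ := mul_right_comm _ _ _
  by_contra hz0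
  have hpos : 0 < ‖z‖₊ := nnnorm_pos.mpr hz0
  exact (mul_lt_of_lt_one_left hpos hn).not_ge hz

/-- For `c` commuting with `a`, both off-diagonal parts of `c` relative to the idempotent `a * x`
are fixed by multiplying with `residual a x` on one side and with `x` on the other. -/
theorem IsCommutingOuterInverse.commute_of_spectralRadius_mul_lt_one
    (h : IsCommutingOuterInverse a x)
    (hr : spectralRadius ℂ (residual a x) * spectralRadius ℂ x < 1) (hc : Commute a c) :
    Commute x c := by
  have hupper : (1 - a * x) * c * (a * x) = 0 := by
    refine eq_zero_of_eq_mul_mul hr ?_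
    calc (1 - a * x) * c * (a * x) = (1 - a * x) * (c * a) * x := by simp only [mul_assoc]
      _ = residual a x * c * x := by
        rw [h.residual_eq_one_sub_mul, ← hc.eq]; simp only [mul_assoc]
      _ = residual a x * (1 - a * x) * c * (a * x * x) := by
        rw [h.mul_mul_right, residual_eq_mul_one_sub,
          mul_assoc a (1 - a * x) (1 - a * x), h.isIdempotentElem_mul.one_sub.eq]
      _ = residual a x * ((1 - a * x) * c * (a * x)) * x := by simp only [mul_assoc]
  have hlower : a * x * c * (1 - a * x) = 0 := by
    refine eq_zero_of_eq_mul_mul (mul_comm _ (spectralRadius ℂ x) ▸ hr) ?_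
    calc a * x * c * (1 - a * x) = x * (a * c) * (1 - a * x) := by
          rw [h.commute.eq]; simp only [mul_assoc]
      _ = x * c * residual a x := by
        rw [residual_eq_mul_one_sub, hc.eq]; simp only [mul_assoc]
      _ = x * a * x * c * ((1 - a * x) * residual a x) := by
        rw [h.mul_mul_self, h.residual_eq_one_sub_mul, ← mul_assoc (1 - a * x),
          h.isIdempotentElem_mul.one_sub.eq]
      _ = x * (a * x * c * (1 - a * x)) * residual a x := by simp only [mul_assoc]
  have hac : a * x * c = c * (a * x) := by
    linear_combination (norm := noncomm_ring) hlower - hupper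
  calc x * c = x * (a * x * c) := by rw [← mul_assoc, ← mul_assoc, h.mul_mul_self]
    _ = x * (c * a) * x := by rw [hac]; simp only [mul_assoc]
    _ = a * x * c * x := by rw [← hc.eq, h.commute.eq]; simp only [mul_assoc]
    _ = c * x := by rw [hac, mul_assoc, h.mul_mul_right]

end SpectralRadius

section Quasinilpotent

variable {A : Type*} [NormedRing A] [NormedAlgebra ℂ A] {a b e u v x y : A}

theorem nontrivial_of_nonempty_spectrum {k A : Type*} [CommRing k] [Ring A] [Algebra k A] {a : A}
    (h : (spectrum k a).Nonempty) : Nontrivial A := by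
  by_contra hA
  rw [not_nontrivial_iff_subsingleton] at hA
  exact h.ne_empty (spectrum.of_subsingleton a)

theorem IsQuasinilpotent.nontrivial (h : IsQuasinilpotent a) : Nontrivial A :=
  nontrivial_of_nonempty_spectrum (k := ℂ) (h ▸ Set.singleton_nonempty 0)

theorem isQuasinilpotent_zero [Nontrivial A] : IsQuasinilpotent (0 : A) :=
  spectrum.zero_eq

theorem IsQuasinilpotent.spectralRadius_eq_zero (h : IsQuasinilpotent a) :
    spectralRadius ℂ a = 0 := by
  rw [IsQuasinilpotent] at h
  simp [spectralRadius, h]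

theorem IsQuasinilpotent.isUnit_algebraMap_sub (h : IsQuasinilpotent a) {z : ℂ} (hz : z ≠ 0) :
    IsUnit (algebraMap ℂ A z - a) :=
  spectrum.notMem_iff.mp (h ▸ hz)

variable [CompleteSpace A]

theorem isQuasinilpotent_of_spectrum_subset [Nontrivial A] (h : spectrum ℂ a ⊆ {0}) :
    IsQuasinilpotent a :=
  (spectrum.nonempty a).subset_singleton_iff.mp h

theorem isQuasinilpotent_of_spectralRadius_eq_zero [Nontrivial A] (h : spectralRadius ℂ a = 0) :
    IsQuasinilpotent a := by
  refine isQuasinilpotent_of_spectrum_subset fun z hz => ?_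
  have hle : (‖z‖₊ : ENNReal) ≤ spectralRadius ℂ a := le_iSup₂ (α := ENNReal) z hz
  simpa [h] using hle

theorem IsQuasinilpotent.mul (ha : IsQuasinilpotent a) (h : Commute a b) :
    IsQuasinilpotent (a * b) := by
  have := ha.nontrivial
  refine isQuasinilpotent_of_spectralRadius_eq_zero (le_antisymm ?_ bot_le)
  simpa only [ha.spectralRadius_eq_zero, zero_mul] using spectralRadius_mul_le h

theorem IsQuasinilpotent.peirceSum (hu : IsQuasinilpotent u) (hv : IsQuasinilpotent v)
    (he : IsIdempotentElem e) (hue : Commute u e) (hve : Commute v e) :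
    IsQuasinilpotent (peirceSum e u v) := by
  have := hu.nontrivial
  refine isQuasinilpotent_of_spectrum_subset ((spectrum_peirceSum_subset he hue hve).trans ?_)
  rw [hu, hv, Set.union_self]

end Quasinilpotent

section GDrazin

variable {A : Type*} [NormedRing A] [NormedAlgebra ℂ A] {a b c e u v x y : A}

theorem isGDrazinInverse_iff :
    IsGDrazinInverse a x ↔ IsCommutingOuterInverse a x ∧ IsQuasinilpotent (residual a x) :=
  ⟨fun h => ⟨⟨h.1 a rfl, h.2.1⟩, h.2.2⟩,
    fun h => ⟨by rintro _ rfl; exact h.1.commute, h.1.mul_mul_self, h.2⟩⟩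

theorem IsGDrazinInverse.isCommutingOuterInverse (h : IsGDrazinInverse a x) :
    IsCommutingOuterInverse a x :=
  (isGDrazinInverse_iff.mp h).1

theorem IsGDrazinInverse.isQuasinilpotent_residual (h : IsGDrazinInverse a x) :
    IsQuasinilpotent (residual a x) :=
  (isGDrazinInverse_iff.mp h).2

theorem IsGDrazinInvertible.nontrivial (h : IsGDrazinInvertible a) : Nontrivial A :=
  h.choose_spec.isQuasinilpotent_residual.nontrivial

theorem isGDrazinInverse_units_inv [Nontrivial A] (u : Aˣ) :
    IsGDrazinInverse (u : A) (↑u⁻¹ : A) := by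
  refine isGDrazinInverse_iff.mpr ⟨isCommutingOuterInverse_units_inv u, ?_⟩
  rw [residual_units_inv]
  exact isQuasinilpotent_zero

theorem isGDrazinInvertible_of_isUnit [Nontrivial A] (h : IsUnit a) : IsGDrazinInvertible a :=
  let ⟨u, hu⟩ := h
  ⟨_, hu ▸ isGDrazinInverse_units_inv u⟩

theorem IsQuasinilpotent.isGDrazinInverse_zero (h : IsQuasinilpotent a) :
    IsGDrazinInverse a 0 := by
  refine isGDrazinInverse_iff.mpr ⟨isCommutingOuterInverse_zero a, ?_⟩
  rwa [residual_zero_right]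

theorem IsGDrazinInvertible.exists_peirceSum_eq {l : ℂ}
    (h : IsGDrazinInvertible (a - algebraMap ℂ A l)) :
    ∃ e c n : A, IsIdempotentElem e ∧ Commute c e ∧ Commute n e ∧ l ∉ spectrum ℂ c ∧
      spectrum ℂ n = {l} ∧ AgDrazin.peirceSum e c n = a := by
  obtain ⟨y, hy⟩ := h
  set u : A := a - algebraMap ℂ A l with hu
  have hi := hy.isCommutingOuterInverse
  have hle : Commute (algebraMap ℂ A l) (u * y) := Algebra.commute_algebraMap_left l _
  refine ⟨u * y, AgDrazin.peirceSum (u * y) u 1 + algebraMap ℂ A l,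
    residual u y + algebraMap ℂ A l, hi.isIdempotentElem_mul, ?_, ?_, ?_, ?_, ?_⟩
  · exact (commute_peirceSum hi.commute_left_mul (Commute.one_left _)).add_left hle
  · exact hi.commute_residual_mul.add_left hle
  · rw [spectrum.notMem_iff, sub_add_cancel_right, IsUnit.neg_iff]
    exact hi.isUnit_peirceSum_one
  · rw [← spectrum.add_singleton_eq, hy.isQuasinilpotent_residual, Set.singleton_add_singleton,
      zero_add]
  · rw [peirceSum_add_self, hi.peirceSum_residual, hu, sub_add_cancel]

variable [CompleteSpace A]

theorem IsGDrazinInverse.commute (h : IsGDrazinInverse a x) (hc : Commute a c) : Commute x c := by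
  refine h.isCommutingOuterInverse.commute_of_spectralRadius_mul_lt_one ?_ hc
  rw [h.isQuasinilpotent_residual.spectralRadius_eq_zero, zero_mul]
  exact one_pos

theorem IsGDrazinInverse.peirceSum (hx : IsGDrazinInverse u x) (hy : IsGDrazinInverse v y)
    (he : IsIdempotentElem e) (hue : Commute u e) (hve : Commute v e) :
    IsGDrazinInverse (peirceSum e u v) (peirceSum e x y) := by
  have hxe : Commute x e := hx.commute hue
  have hye : Commute y e := hy.commute hve
  refine isGDrazinInverse_iff.mpr ⟨isCommutingOuterInverse_peirceSum hx.isCommutingOuterInverse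
    hy.isCommutingOuterInverse he hue hve hxe hye, ?_⟩
  rw [residual_peirceSum he hue hve hxe hye]
  exact hx.isQuasinilpotent_residual.peirceSum hy.isQuasinilpotent_residual he
    (commute_residual hue.symm hxe.symm).symm (commute_residual hve.symm hye.symm).symm

theorem IsGDrazinInvertible.peirceSum (hu : IsGDrazinInvertible u) (hv : IsGDrazinInvertible v)
    (he : IsIdempotentElem e) (hue : Commute u e) (hve : Commute v e) :
    IsGDrazinInvertible (peirceSum e u v) :=
  let ⟨_, hx⟩ := hu
  let ⟨_, hy⟩ := hv
  ⟨_, hx.peirceSum hy he hue hve⟩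

theorem IsGDrazinInvertible.mul_isUnit (hu : IsGDrazinInvertible u) (hv : IsUnit v)
    (h : Commute u v) : IsGDrazinInvertible (u * v) := by
  have := hu.nontrivial
  obtain ⟨y, hy⟩ := hu
  have hi := hy.isCommutingOuterInverse
  have hve : Commute v (u * y) := h.symm.mul_right (hy.commute h).symm
  have hcore : Commute (AgDrazin.peirceSum (u * y) u 1) (u * y) :=
    commute_peirceSum hi.commute_left_mul (Commute.one_left _)
  have hnv : Commute (residual u y) v := (commute_residual h.symm (hy.commute h).symm).symm
  obtain ⟨w, hw⟩ := hi.isUnit_peirceSum_one.mul hv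
  rw [← hi.peirceSum_residual, ← peirceSum_self (u * y) v,
    peirceSum_mul hi.isIdempotentElem_mul hve hve, ← hw]
  exact ⟨_, (isGDrazinInverse_units_inv w).peirceSum
    (hy.isQuasinilpotent_residual.mul hnv).isGDrazinInverse_zero hi.isIdempotentElem_mul
    (hw ▸ hcore.mul_left hve) (hi.commute_residual_mul.mul_left hve)⟩

end GDrazin

section AgDrazinInverse

variable {A : Type*} [NormedRing A] [NormedAlgebra ℂ A] {a b x y : A}

theorem isAgDrazinInverse_iff :
    IsAgDrazinInverse a x ↔ IsCommutingOuterInverse a x ∧ IsAcc (residual a x) :=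
  ⟨fun h => ⟨⟨h.1 a rfl, h.2.1⟩, h.2.2⟩,
    fun h => ⟨by rintro _ rfl; exact h.1.commute, h.1.mul_mul_self, h.2⟩⟩

theorem IsAgDrazinInverse.isCommutingOuterInverse (h : IsAgDrazinInverse a x) :
    IsCommutingOuterInverse a x :=
  (isAgDrazinInverse_iff.mp h).1

theorem IsAgDrazinInverse.isAcc_residual (h : IsAgDrazinInverse a x) : IsAcc (residual a x) :=
  (isAgDrazinInverse_iff.mp h).2

theorem IsAcc.nontrivial (h : IsAcc a) : Nontrivial A :=
  (h 1 one_ne_zero).nontrivial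

variable [CompleteSpace A]

theorem IsAcc.add (ha : IsAcc a) (hb : IsQuasinilpotent b) (hab : a * b = 0) (hba : b * a = 0) :
    IsAcc (a + b) := by
  intro z hz
  have hfactor : a + b - algebraMap ℂ A z =
      (a - algebraMap ℂ A z) * (algebraMap ℂ A z⁻¹ * (algebraMap ℂ A z - b)) :=
    calc a + b - algebraMap ℂ A z
        = algebraMap ℂ A z⁻¹ * (algebraMap ℂ A z * (a + b - algebraMap ℂ A z)) := by
          rw [← mul_assoc, ← map_mul, inv_mul_cancel₀ hz, map_one, one_mul]
      _ = algebraMap ℂ A z⁻¹ * ((a - algebraMap ℂ A z) * (algebraMap ℂ A z - b)) := by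
          rw [← neg_sub _ (a + b), ← neg_sub _ a, neg_mul, mul_neg,
            algebraMap_sub_mul_algebraMap_sub hab]
      _ = (a - algebraMap ℂ A z) * (algebraMap ℂ A z⁻¹ * (algebraMap ℂ A z - b)) :=
          (Algebra.left_comm _ _ _).symm
  have hunit : IsUnit (algebraMap ℂ A z⁻¹ * (algebraMap ℂ A z - b)) :=
    ((IsUnit.mk0 _ (inv_ne_zero hz)).map (algebraMap ℂ A)).mul (hb.isUnit_algebraMap_sub hz)
  have hcomm : Commute (a - algebraMap ℂ A z) (algebraMap ℂ A z - b) :=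
    ((Algebra.commute_algebraMap_right z _).sub_right
      (Commute.sub_left (hab.trans hba.symm) (Algebra.commute_algebraMap_left z b)))
  rw [hfactor]
  exact (ha z hz).mul_isUnit hunit ((Algebra.commute_algebraMap_right _ _).mul_right hcomm)

theorem IsAgDrazinInverse.add (hx : IsAgDrazinInverse a x) (hy : IsGDrazinInverse b y)
    (hab : a * b = 0) (hba : b * a = 0) : IsAgDrazinInverse (a + b) (x + y) := by
  have hxo := hx.isCommutingOuterInverse
  have hyo := hy.isCommutingOuterInverse
  refine isAgDrazinInverse_iff.mpr ⟨hxo.add hyo hab hba, ?_⟩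
  rw [hxo.residual_add hyo hab hba]
  exact hx.isAcc_residual.add hy.isQuasinilpotent_residual (hxo.residual_mul_residual hab)
    (hyo.residual_mul_residual hba)

end AgDrazinInverse

section DoubleCommutant

variable {A : Type*} [NormedRing A] [NormedAlgebra ℂ A] [CompleteSpace A] {a e c x : A}

theorem IsAcc.not_accPt (h : IsAcc a) {l : ℂ} (hl : l ≠ 0) : ¬AccPt l (𝓟 (spectrum ℂ a)) := by
  obtain ⟨e, c, n, he, hc, hn, hlc, hσn, rfl⟩ := (h l hl).exists_peirceSum_eq
  intro hacc
  have hnear : ∀ᶠ z in 𝓝 l, z ∉ spectrum ℂ c := (spectrum.isClosed c).compl_mem_nhds hlc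
  obtain ⟨z, ⟨hzl, hz⟩, hzc⟩ := ((accPt_iff_frequently.mp hacc).and_eventually hnear).exists
  have hzcn := spectrum_peirceSum_subset he hc hn hz
  rw [hσn] at hzcn
  exact hzcn.elim hzc hzl

theorem IsAcc.finite_spectrum_inter (h : IsAcc a) {δ : ℝ} (hδ : 0 < δ) :
    (spectrum ℂ a ∩ {z | δ ≤ ‖z‖}).Finite := by
  by_contra hinf
  have hcompact : IsCompact (spectrum ℂ a ∩ {z | δ ≤ ‖z‖}) :=
    (spectrum.isCompact a).inter_right (isClosed_le continuous_const continuous_norm)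
  obtain ⟨l, hl, hacc⟩ := Set.Infinite.exists_accPt_of_subset_isCompact hinf hcompact subset_rfl
  exact h.not_accPt (norm_pos_iff.mp (hδ.trans_le hl.2))
    (hacc.mono (principal_mono.mpr Set.inter_subset_left))

theorem IsAcc.peirceSum_zero (h : IsAcc (peirceSum e a c)) (he : IsIdempotentElem e)
    (ha : Commute a e) (hc : Commute c e) : IsAcc (peirceSum e a 0) := by
  intro z hz
  have := h.nontrivial
  have hze : Commute (algebraMap ℂ A z) e := Algebra.commute_algebraMap_left z e
  have hunit : IsUnit (0 - algebraMap ℂ A z) := by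
    rw [zero_sub]
    exact ((IsUnit.mk0 z hz).map (algebraMap ℂ A)).neg
  rw [← peirceSum_peirceSum_left he a c, ← peirceSum_sub_self]
  exact (h z hz).peirceSum (isGDrazinInvertible_of_isUnit hunit) he
    ((commute_peirceSum ha hc).sub_left hze) ((Commute.zero_left e).sub_left hze)

theorem IsAcc.exists_isAgDrazinInverse_spectrum_subset (h : IsAcc a) {l : ℂ} (hl : l ≠ 0) :
    ∃ y, IsAgDrazinInverse a y ∧ spectrum ℂ (residual a y) ⊆ insert 0 (spectrum ℂ a \ {l}) ∧
      spectrum ℂ y ⊆ {0, l⁻¹} := by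
  have := h.nontrivial
  obtain ⟨e, c, n, he, hc, hn, hlc, hσn, rfl⟩ := (h l hl).exists_peirceSum_eq
  obtain ⟨w, rfl⟩ : IsUnit n :=
    (spectrum.zero_notMem_iff ℂ).mp (hσn ▸ hl.symm)
  have h0 : Commute (0 : A) e := Commute.zero_left e
  have hw : Commute (↑w⁻¹ : A) e := hn.units_inv_left
  have hres : residual (peirceSum e c w) (peirceSum e 0 ↑w⁻¹) = peirceSum e c 0 := by
    rw [residual_peirceSum he hc hn h0 hw, residual_zero_right, residual_units_inv]
  have hσc : spectrum ℂ (peirceSum e c 0) ⊆ spectrum ℂ c ∪ {0} := by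
    simpa only [spectrum.zero_eq] using spectrum_peirceSum_subset (k := ℂ) he hc h0
  have hσa : spectrum ℂ (peirceSum e c 0) ⊆ spectrum ℂ (peirceSum e c w) ∪ {0} := by
    simpa only [spectrum.zero_eq, peirceSum_peirceSum_left he] using
      spectrum_peirceSum_subset (k := ℂ) he (commute_peirceSum hc hn) h0
  refine ⟨peirceSum e 0 ↑w⁻¹, isAgDrazinInverse_iff.mpr ⟨?_, ?_⟩, ?_, ?_⟩
  · exact isCommutingOuterInverse_peirceSum (isCommutingOuterInverse_zero c)
      (isCommutingOuterInverse_units_inv w) he hc hn h0 hw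
  · rw [hres]
    exact h.peirceSum_zero he hc hn
  · rw [hres]
    intro z hz
    rcases hσc hz with hzc | hz0
    · exact (hσa hz).symm.imp id fun hza => ⟨hza, fun hzl => hlc (hzl ▸ hzc)⟩
    · exact Or.inl hz0
  · refine (spectrum_peirceSum_subset he h0 hw).trans ?_
    rw [spectrum.zero_eq, ← spectrum.map_inv, hσn, Set.inv_singleton, Set.singleton_union]

theorem IsAgDrazinInverse.exists_spectrum_subset_diff (hx : IsAgDrazinInverse a x) {S : Set ℂ}
    (hS : S.Finite) (hS0 : 0 ∉ S) :
    ∃ y, IsAgDrazinInverse a y ∧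
      spectrum ℂ (residual a y) ⊆ insert 0 (spectrum ℂ (residual a x) \ S) ∧
      spectrum ℂ y ⊆ insert 0 (spectrum ℂ x ∪ S⁻¹) := by
  induction S, hS using Set.Finite.induction_on with
  | empty => exact ⟨x, hx, by simp [Set.subset_insert], by simp [Set.subset_insert]⟩
  | @insert l S _ _ ih =>
    rw [Set.mem_insert_iff, not_or] at hS0
    obtain ⟨y, hy, hσres, hσy⟩ := ih hS0.2
    obtain ⟨w, hw, hσres', hσw⟩ :=
      hy.isAcc_residual.exists_isAgDrazinInverse_spectrum_subset (Ne.symm hS0.1)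
    have hyo := hy.isCommutingOuterInverse
    have hwo := hw.isCommutingOuterInverse
    have hyw : y * w = 0 := hwo.mul_right_eq_zero hyo.right_mul_residual
    have hres := hyo.residual_add_of_residual hwo
    refine ⟨y + w, isAgDrazinInverse_iff.mpr ⟨hyo.add_of_residual hwo, ?_⟩, ?_, ?_⟩
    · exact hres ▸ hw.isAcc_residual
    · rw [hres]
      intro z hz
      rcases hσres' hz with hz0 | ⟨hzy, hzl⟩
      · exact Or.inl hz0
      · exact (hσres hzy).imp_right fun ⟨hzx, hzS⟩ => ⟨hzx, not_or.mpr ⟨hzl, hzS⟩⟩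
    · intro z hz
      rcases spectrum_add_subset_of_mul_eq_zero hyw hz with hzy | hzw
      · exact (hσy hzy).imp_right (Or.imp_right Or.inr)
      · rcases hσw hzw with hz0 | rfl
        · exact Or.inl hz0
        · exact Or.inr (Or.inr (Or.inl (inv_inv l)))

theorem IsAgDrazinInvertible.exists_spectralRadius_mul_lt_one (h : IsAgDrazinInvertible a) :
    ∃ x, IsAgDrazinInverse a x ∧ spectralRadius ℂ (residual a x) * spectralRadius ℂ x < 1 := by
  obtain ⟨x, hx⟩ := h
  have := hx.isAcc_residual.nontrivial
  obtain ⟨M, hM, hxM⟩ := (spectrum.isBounded (𝕜 := ℂ) x).exists_pos_norm_le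
  lift M to NNReal using hM.le
  have hM' : 0 < M := by exact_mod_cast hM
  obtain ⟨y, hy, hσres, hσy⟩ := hx.exists_spectrum_subset_diff
    (hx.isAcc_residual.finite_spectrum_inter (inv_pos.mpr hM)) (by simp [hM'])
  have hres : spectralRadius ℂ (residual a y) < (M⁻¹ : NNReal) := by
    refine spectrum.spectralRadius_lt_of_forall_lt _ fun z hz => ?_
    rcases hσres hz with rfl | ⟨hz, hzS⟩
    · simpa using hM'
    · exact lt_of_not_ge fun hle => hzS ⟨hz, by exact_mod_cast hle⟩
  have hyM : spectralRadius ℂ y ≤ M := by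
    refine iSup₂_le fun z hz => ENNReal.coe_le_coe.mpr ?_
    rcases hσy hz with rfl | hzx | ⟨_, hzS⟩
    · simp
    · exact_mod_cast hxM z hzx
    · have hzM := inv_le_of_inv_le₀ hM hzS
      rw [norm_inv, inv_inv] at hzM
      exact_mod_cast hzM
  refine ⟨y, hy, ?_⟩
  calc spectralRadius ℂ (residual a y) * spectralRadius ℂ y
      ≤ spectralRadius ℂ (residual a y) * M := by gcongr
    _ < 1 := ENNReal.mul_lt_of_lt_div (by rwa [one_div, ← ENNReal.coe_inv hM'.ne'])

theorem IsAgDrazinInvertible.exists_mem_centralizer_centralizer (h : IsAgDrazinInvertible a) :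
    ∃ x ∈ Set.centralizer (Set.centralizer {a}), IsAgDrazinInverse a x := by
  obtain ⟨x, hx, hr⟩ := h.exists_spectralRadius_mul_lt_one
  refine ⟨x, fun c hc => ?_, hx⟩
  exact (hx.isCommutingOuterInverse.commute_of_spectralRadius_mul_lt_one hr (hc a rfl)).symm.eq

end DoubleCommutant

end AgDrazin

theorem mainTheorem8_general {A : Type*} [NormedRing A] [NormedAlgebra ℂ A] [CompleteSpace A]
    (a b : A) (ha : AgDrazin.IsAgDrazinInvertible a) (hb : AgDrazin.IsGDrazinInvertible b)
    (hab : a * b = 0) (hba : b * a = 0) :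
    AgDrazin.IsAgDrazinInvertible (a + b) ∧
    (∃ x ∈ Set.centralizer (Set.centralizer ({a} : Set A)), AgDrazin.IsAgDrazinInverse a x) ∧
    (∀ x : A, AgDrazin.IsAgDrazinInverse a x → ∀ y : A, AgDrazin.IsGDrazinInverse b y →
      AgDrazin.IsAgDrazinInverse (a + b) (x + y)) := by
  have hadd : ∀ x : A, AgDrazin.IsAgDrazinInverse a x → ∀ y : A, AgDrazin.IsGDrazinInverse b y →
      AgDrazin.IsAgDrazinInverse (a + b) (x + y) := fun _ hx _ hy => hx.add hy hab hba
  obtain ⟨x, hx⟩ := ha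
  obtain ⟨y, hy⟩ := hb
  exact ⟨⟨x + y, hadd x hx y hy⟩,
    AgDrazin.IsAgDrazinInvertible.exists_mem_centralizer_centralizer ⟨x, hx⟩, hadd⟩

theorem mainTheorem8 {A : Type*} [NormedRing A] [NormedAlgebra ℂ A] [CompleteSpace A]
    (a b : A) (ha : AgDrazin.IsAgDrazinInvertible a) (hb : AgDrazin.IsGDrazinInvertible b)
    (hab : a * b = 0) (hba : b * a = 0) :
    AgDrazin.IsAgDrazinInvertible (a + b) ∧
    (∃ x ∈ Set.centralizer (Set.centralizer ({a} : Set A)), AgDrazin.IsAgDrazinInverse a x) ∧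
    (∀ x ∈ Set.centralizer (Set.centralizer ({a} : Set A)), AgDrazin.IsAgDrazinInverse a x →
      ∀ y : A, AgDrazin.IsGDrazinInverse b y →
        AgDrazin.IsAgDrazinInverse (a + b) (x + y)) := by
  obtain ⟨hsum, hmem, hadd⟩ := mainTheorem8_general a b ha hb hab hba
  exact ⟨hsum, hmem, fun x _ => hadd x⟩
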